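/- **Setting.** Let $\beta>0$, $L>0$, and let $l$ be the integer part of $\beta$ (the greatest integer $\le\beta$ or the greatest integer $<\beta$; the result holds with either convention, i.e. for every integer $l\ge 0$ with $l\le\beta\le l+1$). The Hölder class $\mathcal H(\beta,L)$ is the set of all $l$ times continuously differentiable $g:\mathbb R\to\mathbb R$ with $|g^{(l)}(u)-g^{(l)}(u')|\le L|u-u'|^{\beta-l}$ for all $u,u'\in\mathbb R$. There are a target domain $k=0$ and source domains $k=1,\dots,K$ with $K\ge1$, with sample sizes $n_0\ge1$ and $n_1,\dots,n_K\ge 0$ (in particular, equal or comparable sizes are allowed), and $n=\sum_{k=0}^K n_k$. The target domain has a fixed index $U_0=u_0\in\mathbb R$; the source indices $U_1,\dots,U_K$ are i.i.d. with Lebesgue density $u\mapsto\gamma^{-1}f((u-u^*)/\gamma)$, where $\gamma>0$, $u^*\in\mathbb R$ and $f$ is a probability density with $f\le a_0$. The covariates $X_{ki}\in\mathbb R^p$ ($0\le k\le K$, $1\le i\le n_k$) satisfy $\|X_{ki}\|_2\le1$ almost surely and may otherwise have any joint law given the indices. Given all $U_k$ and $X_{ki}$, the responses $Y_{ki}$ are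 independent with $$Y_{ki}\sim\mathcal N\big(X_{ki}^\top\boldsymbol\theta(U_k),1\big),\qquad \boldsymbol\theta=(\theta_1,\dots,\theta_p).$$ Let $A\in\mathbb R^{p\times p}$ be symmetric positive semidefinite with largest eigenvalue $\lambda_{A,1}$, and let $\|v\|_A^2=v^\top Av$. **Theorem.** There is a constant $c>0$ that depends only on $\beta$, $L$ and $a_0$ (and on the chosen convention for $l$) such that for all $p$, $A$, $K\ge1$, $n_0\ge1$, $n_1,\dots,n_K$, $\gamma>0$, $u_0$, $u^*$, all densities $f\le a_0$, and all laws of the covariates as above, $$\inf_{\hat{\boldsymbol\theta}(u_0)}\ \sup_{\theta_1,\dots,\theta_p\in\mathcal H(\beta,L)}\mathbb E\,\big\|\hat{\boldsymbol\theta}(u_0)-\boldsymbol\theta(u_0)\big\|_A^2\ \ge\ C\left[\frac1{n_0}\wedge\max\left\{\Big(\frac K\gamma\Big)^{-2\beta},\ \Big(\frac n\gamma\Big)^{-\frac{2\beta}{2\beta+1}},\ \frac1n\right\}\right],\qquad C=c\,\lambda_{A,1},$$ where the infimum is over all estimators based on the data $\{(U_k,X_{ki},Y_{ki})\}$, randomized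 estimators included. In particular $C>0$ whenever $A\ne0$. -/

import Mathlib

open MeasureTheory ProbabilityTheory
open scoped ENNReal Matrix

/-- `IsHolder l β L g`: the function `g : ℝ → ℝ` lies in the Hölder class `H(β, L)`, where `l` is
the integer part of `β`: `g` is `l` times continuously differentiable and
`|g^(l)(u) - g^(l)(u')| ≤ L |u - u'|^(β - l)`. -/
def IsHolder (l : ℕ) (β L : ℝ) (g : ℝ → ℝ) : Prop :=
  ContDiff ℝ l g ∧
    ∀ u u' : ℝ, |iteratedDeriv l g u - iteratedDeriv l g u'| ≤ L * |u - u'| ^ (β - (l : ℝ))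

/-- The law on `ℝ` with Lebesgue density `u ↦ γ⁻¹ f ((u - uStar) / γ)`. -/
noncomputable def sourceLaw (f : ℝ → ℝ) (uStar γ : ℝ) : Measure ℝ :=
  volume.withDensity fun u => ENNReal.ofReal (γ⁻¹ * f ((u - uStar) / γ))

/-- A realisation `(U, X)` of all covariates: the indices `U_1, …, U_K` of the source domains
(here numbered from zero), and the covariates `X_{ki} ∈ ℝ^p`, `i ≤ n_k`, of all the domains
`k = 0, …, K`, where `k = 0` is the target domain. -/
abbrev Design (p K : ℕ) (n : Fin (K + 1) → ℕ) : Type :=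
  (Fin K → ℝ) × ((k : Fin (K + 1)) → Fin (n k) → EuclideanSpace ℝ (Fin p))

/-- A real number (a response or a noise variable) for every observation. -/
abbrev Responses (K : ℕ) (n : Fin (K + 1) → ℕ) : Type :=
  (k : Fin (K + 1)) → Fin (n k) → ℝ

/-- The index of every domain: `u₀` for the target domain, and `U_k` for the source domains. -/
def domainIndex {K : ℕ} (u₀ : ℝ) (U : Fin K → ℝ) : Fin (K + 1) → ℝ :=
  Fin.cons u₀ U

/-- The law of the covariates is admissible: the indices of the source domains are independent with
the common law `sourceLaw f uStar γ`, and all covariates satisfy `‖X_{ki}‖₂ ≤ 1` almost surely. The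
conditional law of the covariates `X_{ki}` given the indices is otherwise arbitrary. -/
structure IsAdmissibleDesign {p K : ℕ} {n : Fin (K + 1) → ℕ} (f : ℝ → ℝ) (uStar γ : ℝ)
    (D : Measure (Design p K n)) : Prop where
  indices : D.map Prod.fst = Measure.pi fun _ : Fin K => sourceLaw f uStar γ
  bounded : ∀ᵐ d ∂D, ∀ k i, ‖d.2 k i‖ ≤ 1

/-- The law of independent standard normal noise variables `ε_{ki}`. -/
noncomputable def noiseLaw (K : ℕ) (n : Fin (K + 1) → ℕ) : Measure (Responses K n) :=
  Measure.pi fun k => Measure.pi fun _ : Fin (n k) => gaussianReal 0 1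

/-- The class of all coefficient functions `θ = (θ_1, …, θ_p)` with coordinates in `H(β, L)`. -/
def CoeffClass (p l : ℕ) (β L : ℝ) : Type :=
  {θ : Fin p → ℝ → ℝ // ∀ j, IsHolder l β L (θ j)}

/-- The parameter set carries the discrete `σ`-algebra: there is no measurability requirement in the
parameter, since only the risk at each single `θ` matters. -/
instance (p l : ℕ) (β L : ℝ) : MeasurableSpace (CoeffClass p l β L) := ⊤

/-- The observed data `(U, X, Y)`, with `Y_{ki} = X_{ki}ᵀ θ(U_k) + ε_{ki}`. -/
def observe {p K : ℕ} {n : Fin (K + 1) → ℕ} (u₀ : ℝ) (θ : Fin p → ℝ → ℝ)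
    (ω : Design p K n × Responses K n) : Design p K n × Responses K n :=
  (ω.1, fun k i => (∑ j, ω.1.2 k i j * θ j (domainIndex u₀ ω.1.1 k)) + ω.2 k i)

lemma CoeffClass.measurable_coord {p l : ℕ} {β L : ℝ} (θ : CoeffClass p l β L)
    (j : Fin p) : Measurable (θ.1 j) :=
  (θ.2 j).1.continuous.measurable

lemma measurable_observe {p K : ℕ} {n : Fin (K + 1) → ℕ} (u₀ : ℝ) (θ : Fin p → ℝ → ℝ)
    (hθ : ∀ j, Measurable (θ j)) :
    Measurable (observe u₀ θ : Design p K n × Responses K n → Design p K n × Responses K n) := by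
  have hU : ∀ k, Measurable fun ω : Design p K n × Responses K n =>
      domainIndex u₀ ω.1.1 k := by
    intro k
    refine Fin.cases ?_ (fun k' => ?_) k
    · simp only [domainIndex, Fin.cons_zero]
      exact measurable_const
    · simp only [domainIndex, Fin.cons_succ]
      fun_prop
  refine measurable_fst.prodMk (measurable_pi_lambda _ fun k => measurable_pi_lambda _ fun i => ?_)
  refine Measurable.add (Finset.measurable_sum _ fun j _ => ?_) (by fun_prop)
  exact Measurable.mul (by fun_prop) ((hθ j).comp (hU k))

/-- The statistical model: `dataLaw l β L u₀ D θ` is the law of the data `(U, X, Y)` when the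
coefficient functions are `θ` and the covariates have the law `D`. The noise is independent of the
covariates, so that, given the covariates, the `Y_{ki}` are independent with the laws
`N(X_{ki}ᵀ θ(U_k), 1)`. -/
noncomputable def dataLaw {p K : ℕ} {n : Fin (K + 1) → ℕ} (l : ℕ) (β L u₀ : ℝ)
    (D : Measure (Design p K n)) :
    Kernel (CoeffClass p l β L) (Design p K n × Responses K n) where
  toFun θ := (D.prod (noiseLaw K n)).map (observe u₀ θ.1)
  measurable' := measurable_from_top

/-- The squared `A`-norm `vᵀ A v`. -/
def sqNormA {p : ℕ} (A : Matrix (Fin p) (Fin p) ℝ) (v : Fin p → ℝ) : ℝ :=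
  v ⬝ᵥ (A *ᵥ v)

/-- The loss `‖t - θ(u₀)‖_A²` of the value `t` of an estimator of `θ(u₀)`. -/
noncomputable def lossA {p l : ℕ} {β L : ℝ} (A : Matrix (Fin p) (Fin p) ℝ) (u₀ : ℝ)
    (θ : CoeffClass p l β L) (t : Fin p → ℝ) : ℝ≥0∞ :=
  ENNReal.ofReal (sqNormA A (t - fun j => θ.1 j u₀))

/-- The rate `n₀⁻¹ ∧ max {(K/γ)^(-2β), (N/γ)^(-2β/(2β+1)), N⁻¹}`, where `N` is the total sample
size. -/
noncomputable def tlRate (β γ : ℝ) {K : ℕ} (n : Fin (K + 1) → ℕ) : ℝ :=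
  min ((n 0 : ℝ)⁻¹)
    (max (((K : ℝ) / γ) ^ (-(2 * β)))
      (max ((((∑ k, n k : ℕ) : ℝ) / γ) ^ (-(2 * β) / (2 * β + 1))) (((∑ k, n k : ℕ) : ℝ)⁻¹)))

/-!
The lower bound is Le Cam's two-point method. Let `v` be a unit eigenvector of `A` for its largest
eigenvalue `λ`, and let `g` be a scalar function in the Hölder class. The two hypotheses are `θ = 0`
and `θ = v g`, whose values at `u₀` are at squared `A`-distance `λ g(u₀)²`. Given the covariates, the
responses are Gaussian with identity covariance under both hypotheses, and since `|X_{ki}ᵀ v| ≤ 1`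
the squared distance of the two mean vectors is at most `S = ∑ n_k g(U_k)²`. If `S ≤ s` with
probability at least one half, the minimax risk is at least `e^(-s/2) / 16 · λ g(u₀)²`
(`le_minimaxRisk_of_eigenvalue`).

The comparison of the two Gaussian laws avoids divergences (`le_lintegral_add_lintegral_shift`): by
the Cameron–Martin formula, the law shifted by `m` has the density `exp (⟨m, y⟩ - ‖m‖² / 2)`, which
is at least `exp (-s / 2)` on the half-space `⟨m, y⟩ ≥ 0`, and this half-space has mass at least one
half by symmetry.

Each of the three terms of the rate comes from one choice of `g`. For the first two, `g` is a bump at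
`u₀` of width `h` and amplitude of order `min (n₀^(-1/2)) (h ^ β)`
(`le_minimaxRisk_of_bump`).
* With `h` a small multiple of `γ / K`, the support of the bump contains no source index with
  probability at least one half, by the union bound (`inv_two_le_measure_forall_notMem`), so the
  source samples carry no information; this gives `(K / γ) ^ (-2β)`.
* With `h ^ (2β + 1) = γ / N`, the expected contribution of the source samples to `S` is bounded
  (`inv_two_le_measure_sum_indicator_le`); this gives `(N / γ) ^ (-2β / (2β + 1))`.
* The constant `g = N ^ (-1/2)` has `S = 1`; this gives `1 / N`.
-/

/-! ### Products of measures with densities, and Gaussian shifts -/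

/-- A product of probability measures with densities has the product density. -/
lemma pi_withDensity_eq {ι : Type*} [Fintype ι] {X : ι → Type*} [∀ i, MeasurableSpace (X i)]
    (μ : ∀ i, Measure (X i)) [∀ i, IsProbabilityMeasure (μ i)] (w : ∀ i, X i → ℝ≥0∞)
    (hw : ∀ i, Measurable (w i)) [∀ i, SigmaFinite ((μ i).withDensity (w i))] :
    (Measure.pi fun i => (μ i).withDensity (w i)) =
      (Measure.pi μ).withDensity fun x => ∏ i, w i (x i) := by
  refine Measure.pi_eq fun s hs => ?_
  have hind : iIndepFun (fun i (x : ∀ i, X i) => (s i).indicator (w i) (x i)) (Measure.pi μ) :=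
    iIndepFun_pi (fun i => ((hw i).indicator (hs i)).aemeasurable)
  have hmeas : ∀ i, Measurable fun x : ∀ i, X i => (s i).indicator (w i) (x i) :=
    fun i => ((hw i).indicator (hs i)).comp (measurable_pi_apply i)
  rw [withDensity_apply _ (.univ_pi hs), ← lintegral_indicator (.univ_pi hs)]
  have hprod : ∀ x : ∀ i, X i, (Set.univ.pi s).indicator (fun x => ∏ i, w i (x i)) x =
      ∏ i, (s i).indicator (w i) (x i) := by
    intro x
    by_cases hx : x ∈ Set.univ.pi s
    · rw [Set.indicator_of_mem hx]
      exact Finset.prod_congr rfl fun i _ => by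
        rw [Set.indicator_of_mem (hx i (Set.mem_univ i))]
    · rw [Set.indicator_of_notMem hx]
      simp only [Set.mem_univ_pi, not_forall] at hx
      obtain ⟨i, hi⟩ := hx
      exact (Finset.prod_eq_zero (Finset.mem_univ i) (Set.indicator_of_notMem hi _)).symm
  simp_rw [hprod]
  rw [lintegral_prod_eq_prod_lintegral_of_indepFun Finset.univ _ hind hmeas]
  refine Finset.prod_congr rfl fun i _ => ?_
  rw [withDensity_apply _ (hs i), ← lintegral_indicator (hs i)]
  exact (measurePreserving_eval μ i).lintegral_comp ((hw i).indicator (hs i))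

lemma gaussianReal_map_const_add_eq_withDensity (m : ℝ) :
    (gaussianReal 0 1).map (fun y => m + y) =
      (gaussianReal 0 1).withDensity fun y => ENNReal.ofReal (Real.exp (m * y - m ^ 2 / 2)) := by
  rw [gaussianReal_map_const_add, gaussianReal_of_var_ne_zero _ one_ne_zero,
    gaussianReal_of_var_ne_zero _ one_ne_zero, ← withDensity_mul _ (measurable_gaussianPDF _ _)
      (by fun_prop)]
  congr 1
  ext y
  simp only [Pi.mul_apply, gaussianPDF, gaussianPDFReal]
  rw [← ENNReal.ofReal_mul (by positivity), mul_assoc _ (Real.exp _) (Real.exp _),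
    ← Real.exp_add]
  congr 3
  simp
  ring

section LowerBound

variable {p l K : ℕ} {n : Fin (K + 1) → ℕ} {β L : ℝ}

instance : IsProbabilityMeasure (noiseLaw K n) := by
  unfold noiseLaw; infer_instance

/-- **Cameron–Martin formula** for the noise: the law of the noise shifted by `m` has the density
`y ↦ exp (⟨m, y⟩ - ‖m‖² / 2)` with respect to the law of the noise. -/
lemma noiseLaw_map_const_add (m : Responses K n) :
    (noiseLaw K n).map (fun y => m + y) =
      (noiseLaw K n).withDensity fun y =>
        ENNReal.ofReal (Real.exp (∑ k, ∑ i, (m k i * y k i - m k i ^ 2 / 2))) := by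
  let w : ∀ k, Fin (n k) → ℝ → ℝ≥0∞ :=
    fun k i y => ENNReal.ofReal (Real.exp (m k i * y - m k i ^ 2 / 2))
  have hw : ∀ k i, Measurable (w k i) := fun k i => by fun_prop
  have hP : ∀ k i, IsProbabilityMeasure ((gaussianReal 0 1).map fun y => m k i + y) :=
    fun k i => Measure.isProbabilityMeasure_map (by fun_prop)
  have hP' : ∀ k i, IsProbabilityMeasure ((gaussianReal 0 1).withDensity (w k i)) :=
    fun k i => gaussianReal_map_const_add_eq_withDensity (m k i) ▸ hP k i
  -- The claim for the observations of a single domain.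
  have hinner : ∀ k, (Measure.pi fun _ : Fin (n k) => gaussianReal 0 1).map
        (fun y i => m k i + y i) =
      (Measure.pi fun _ : Fin (n k) => gaussianReal 0 1).withDensity
        fun y => ∏ i, w k i (y i) := by
    intro k
    rw [← pi_withDensity_eq _ _ (hw k),
      Measure.pi_map_pi (f := fun i y => m k i + y) (fun i => by fun_prop)]
    congr 1
    ext1 i
    exact gaussianReal_map_const_add_eq_withDensity (m k i)
  have hQ : ∀ k, IsProbabilityMeasure ((Measure.pi fun _ : Fin (n k) => gaussianReal 0 1).map
      (fun y i => m k i + y i)) := fun k => Measure.isProbabilityMeasure_map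
    (measurable_pi_lambda _ fun i => by fun_prop).aemeasurable
  have hQ' : ∀ k, IsProbabilityMeasure
      ((Measure.pi fun _ : Fin (n k) => gaussianReal 0 1).withDensity
        fun y => ∏ i, w k i (y i)) := fun k => hinner k ▸ hQ k
  have houter : (noiseLaw K n).map (fun y k i => m k i + y k i) =
      (noiseLaw K n).withDensity fun y => ∏ k, ∏ i, w k i (y k i) := by
    unfold noiseLaw
    rw [← pi_withDensity_eq (fun k => Measure.pi fun _ : Fin (n k) => gaussianReal 0 1)
        (fun k y => ∏ i, w k i (y i)) (fun k => by fun_prop),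
      Measure.pi_map_pi (f := fun k (y : Fin (n k) → ℝ) i => m k i + y i)
        (fun k => (measurable_pi_lambda _ fun i => by fun_prop).aemeasurable)]
    congr 1
    ext1 k
    exact hinner k
  have hexp : ∀ y : Responses K n, ∏ k, ∏ i, w k i (y k i) =
      ENNReal.ofReal (Real.exp (∑ k, ∑ i, (m k i * y k i - m k i ^ 2 / 2))) := by
    intro y
    simp only [w]
    rw [Real.exp_sum, ENNReal.ofReal_prod_of_nonneg fun k _ => (Real.exp_pos _).le]
    refine Finset.prod_congr rfl fun k _ => ?_
    rw [Real.exp_sum, ENNReal.ofReal_prod_of_nonneg fun i _ => (Real.exp_pos _).le]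
  simp_rw [← hexp]
  exact houter

lemma noiseLaw_map_neg : (noiseLaw K n).map (fun y => -y) = noiseLaw K n := by
  have h1 : (gaussianReal 0 1).map (fun y : ℝ => -y) = gaussianReal 0 1 := by
    rw [gaussianReal_map_neg, neg_zero]
  have hS : SigmaFinite ((gaussianReal 0 1).map (fun y : ℝ => -y)) := by
    rw [h1]; infer_instance
  have h2 : ∀ k, (Measure.pi fun _ : Fin (n k) => gaussianReal 0 1).map (fun y i => -y i) =
      Measure.pi fun _ : Fin (n k) => gaussianReal 0 1 := by
    intro k
    rw [Measure.pi_map_pi (f := fun _ y => -y) (fun i => by fun_prop), h1]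
  have hS' : ∀ k, SigmaFinite ((Measure.pi fun _ : Fin (n k) => gaussianReal 0 1).map
      (fun y i => -y i)) := fun k => by rw [h2]; infer_instance
  unfold noiseLaw
  change (Measure.pi fun k => Measure.pi fun _ : Fin (n k) => gaussianReal 0 1).map
    (fun y k i => -y k i) = _
  rw [Measure.pi_map_pi (f := fun k (y : Fin (n k) → ℝ) i => -y i)
    (fun k => (measurable_pi_lambda _ fun i => by fun_prop).aemeasurable)]
  simp_rw [h2]

/-- The noise is symmetric, so every closed half-space through the origin carries at least half of
its law. -/
lemma noiseLaw_halfSpace (m : Responses K n) :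
    2⁻¹ ≤ noiseLaw K n {y | 0 ≤ ∑ k, ∑ i, m k i * y k i} := by
  set E : Set (Responses K n) := {y | 0 ≤ ∑ k, ∑ i, m k i * y k i}
  have hE : MeasurableSet E := measurableSet_le measurable_const (by fun_prop)
  have hneg : noiseLaw K n ((fun y => -y) ⁻¹' E) = noiseLaw K n E := by
    rw [← Measure.map_apply (by fun_prop) hE, noiseLaw_map_neg]
  have hcov : (Set.univ : Set (Responses K n)) ⊆ E ∪ (fun y => -y) ⁻¹' E := by
    intro y _
    rcases le_total 0 (∑ k, ∑ i, m k i * y k i) with h | h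
    · exact Or.inl h
    · refine Or.inr ?_
      simpa [E] using h
  have h1 : 1 ≤ noiseLaw K n E * 2 := by
    calc (1 : ℝ≥0∞) = noiseLaw K n Set.univ := measure_univ.symm
      _ ≤ noiseLaw K n E + noiseLaw K n ((fun y => -y) ⁻¹' E) :=
        (measure_mono hcov).trans (measure_union_le _ _)
      _ = noiseLaw K n E * 2 := by rw [hneg, mul_two]
  simpa using ENNReal.div_le_of_le_mul h1

/-- Two Gaussian shifts at distance at most `√s` cannot be told apart: two nonnegative losses whose
sum is at least `Δ` cannot both be small, one on average under the noise and the other on average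
under the noise shifted by `m`. On the half-space `⟨m, y⟩ ≥ 0` the density of the shifted law is at
least `exp (-s / 2)`. -/
lemma le_lintegral_add_lintegral_shift (m : Responses K n) {s : ℝ}
    (hm : ∑ k, ∑ i, m k i ^ 2 ≤ s) {F₀ F₁ : Responses K n → ℝ≥0∞} (h₁ : Measurable F₁) {Δ : ℝ≥0∞}
    (hΔ : ∀ y, Δ ≤ F₀ y + F₁ y) :
    Δ * (ENNReal.ofReal (Real.exp (-s / 2)) * 2⁻¹) ≤
      ∫⁻ y, F₀ y ∂(noiseLaw K n) + ∫⁻ y, F₁ (m + y) ∂(noiseLaw K n) := by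
  have hs : 0 ≤ s := le_trans
    (Finset.sum_nonneg fun k _ => Finset.sum_nonneg fun i _ => sq_nonneg (m k i)) hm
  set e : ℝ≥0∞ := ENNReal.ofReal (Real.exp (-s / 2)) with he
  have he1 : e ≤ 1 := by
    rw [he, ← ENNReal.ofReal_one]
    exact ENNReal.ofReal_le_ofReal (Real.exp_le_one_iff.2 (by linarith))
  set E : Set (Responses K n) := {y | 0 ≤ ∑ k, ∑ i, m k i * y k i}
  have hE : MeasurableSet E := measurableSet_le measurable_const (by fun_prop)
  set w : Responses K n → ℝ≥0∞ := fun y =>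
    ENNReal.ofReal (Real.exp (∑ k, ∑ i, (m k i * y k i - m k i ^ 2 / 2)))
  have hw : Measurable w := by fun_prop
  have hwE : ∀ y ∈ E, e ≤ w y := by
    intro y hy
    refine ENNReal.ofReal_le_ofReal (Real.exp_le_exp.2 ?_)
    have hy' : 0 ≤ ∑ k, ∑ i, m k i * y k i := hy
    simp only [Finset.sum_sub_distrib, ← Finset.sum_div]
    linarith
  have hshift : ∫⁻ y, F₁ (m + y) ∂(noiseLaw K n) = ∫⁻ y, w y * F₁ y ∂(noiseLaw K n) := by
    rw [← lintegral_map (g := fun y => m + y) h₁ (by fun_prop), noiseLaw_map_const_add,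
      lintegral_withDensity_eq_lintegral_mul _ hw h₁]
    rfl
  calc Δ * (e * 2⁻¹) ≤ Δ * (e * noiseLaw K n E) := by gcongr; exact noiseLaw_halfSpace m
    _ = ∫⁻ _ in E, Δ * e ∂(noiseLaw K n) := by rw [setLIntegral_const, mul_assoc]
    _ ≤ ∫⁻ y in E, (F₀ y + w y * F₁ y) ∂(noiseLaw K n) := by
        refine setLIntegral_mono' hE fun y hy => ?_
        calc Δ * e ≤ (F₀ y + F₁ y) * e := by gcongr; exact hΔ y
          _ = F₀ y * e + e * F₁ y := by ring
          _ ≤ F₀ y * 1 + w y * F₁ y := by gcongr; exact hwE y hy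
          _ = _ := by rw [mul_one]
    _ ≤ ∫⁻ y, (F₀ y + w y * F₁ y) ∂(noiseLaw K n) := setLIntegral_le_lintegral _ _
    _ = _ := by rw [hshift]; exact lintegral_add_right _ (hw.mul h₁)

/-! ### Two hypotheses -/

lemma continuous_sqNormA (A : Matrix (Fin p) (Fin p) ℝ) : Continuous (sqNormA A) := by
  unfold sqNormA
  fun_prop

/-- The quasi-triangle inequality of the squared seminorm, from the parallelogram identity. -/
lemma sqNormA_le_two_mul_add {A : Matrix (Fin p) (Fin p) ℝ} (hA : A.PosSemidef)
    (t v w : Fin p → ℝ) : sqNormA A (w - v) ≤ 2 * (sqNormA A (t - v) + sqNormA A (t - w)) := by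
  have h : 0 ≤ sqNormA A ((t - v) + (t - w)) := by
    simpa [sqNormA] using hA.dotProduct_mulVec_nonneg ((t - v) + (t - w))
  have e : w - v = (t - v) - (t - w) := by abel
  rw [e]
  generalize t - v = a at *
  generalize t - w = b at *
  simp only [sqNormA, Matrix.mulVec_add, Matrix.mulVec_sub, dotProduct_add, add_dotProduct,
    dotProduct_sub, sub_dotProduct] at *
  linarith

/-- The conditional means `X_{ki}ᵀ θ(U_k)` of the responses, given the covariates. -/
def responseMean (u₀ : ℝ) (θ : Fin p → ℝ → ℝ) (d : Design p K n) : Responses K n :=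
  fun k i => ∑ j, d.2 k i j * θ j (domainIndex u₀ d.1 k)

/-- The risk of a randomized estimator `κ` at `θ`, as an iterated integral over the covariates and
the noise. -/
lemma lintegral_comp_dataLaw (A : Matrix (Fin p) (Fin p) ℝ) (u₀ : ℝ) (D : Measure (Design p K n))
    [IsProbabilityMeasure D] (κ : Kernel (Design p K n × Responses K n) (Fin p → ℝ))
    [IsMarkovKernel κ] (θ : CoeffClass p l β L) :
    ∫⁻ t, lossA A u₀ θ t ∂((κ ∘ₖ dataLaw l β L u₀ D) θ) =
      ∫⁻ d, ∫⁻ y, ∫⁻ t, lossA A u₀ θ t ∂(κ (d, responseMean u₀ θ.1 d + y)) ∂(noiseLaw K n) ∂D := by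
  have hloss : Measurable (lossA A u₀ θ) :=
    ((continuous_sqNormA A).measurable.comp (measurable_id.sub_const _)).ennreal_ofReal
  have hF : Measurable fun x => ∫⁻ t, lossA A u₀ θ t ∂(κ x) := hloss.lintegral_kernel
  have hobs := measurable_observe (K := K) (n := n) u₀ θ.1 θ.measurable_coord
  rw [Kernel.comp_apply, Measure.lintegral_bind κ.measurable.aemeasurable hloss.aemeasurable]
  change ∫⁻ x, ∫⁻ t, lossA A u₀ θ t ∂(κ x)
    ∂((D.prod (noiseLaw K n)).map (observe u₀ θ.1)) = _
  rw [lintegral_map hF hobs]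
  exact lintegral_prod _ (hF.comp hobs).aemeasurable

/-- **Le Cam's two-point bound.** If, with probability at least one half, the covariates are such
that the mean responses under `θ₀ = 0` and `θ₁` differ by at most `√s` in the Euclidean norm, then
no estimator separates `θ₀` from `θ₁`, and the minimax risk is at least a multiple of
`‖θ₁(u₀)‖_A²`. -/
lemma le_minimaxRisk_of_two_points {A : Matrix (Fin p) (Fin p) ℝ} (hA : A.PosSemidef) (u₀ : ℝ)
    (D : Measure (Design p K n)) [IsProbabilityMeasure D] (θ₀ θ₁ : CoeffClass p l β L)
    (hθ₀ : ∀ j u, θ₀.1 j u = 0) {G : Set (Design p K n)} (hG : MeasurableSet G)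
    (hDG : 2⁻¹ ≤ D G) {s : ℝ}
    (hs : ∀ᵐ d ∂D, d ∈ G → ∑ k, ∑ i, responseMean u₀ θ₁.1 d k i ^ 2 ≤ s) :
    ENNReal.ofReal (Real.exp (-s / 2) / 16 * sqNormA A fun j => θ₁.1 j u₀) ≤
      minimaxRisk (lossA A u₀) (dataLaw l β L u₀ D) := by
  refine le_iInf₂ fun κ hκ => ?_
  set Δ : ℝ≥0∞ := ENNReal.ofReal (sqNormA A (fun j => θ₁.1 j u₀) / 2) with hΔ
  have hsum : ∀ t, Δ ≤ lossA A u₀ θ₀ t + lossA A u₀ θ₁ t := by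
    intro t
    have h := sqNormA_le_two_mul_add hA t (fun j => θ₀.1 j u₀) (fun j => θ₁.1 j u₀)
    have h0 : (fun j => θ₁.1 j u₀) - (fun j => θ₀.1 j u₀) = fun j => θ₁.1 j u₀ := by
      ext j; simp [hθ₀]
    rw [h0] at h
    refine le_trans (ENNReal.ofReal_le_ofReal ?_) ENNReal.ofReal_add_le
    linarith
  have hmeas : ∀ θ : CoeffClass p l β L, Measurable (lossA A u₀ θ) := fun θ =>
    ((continuous_sqNormA A).measurable.comp (measurable_id.sub_const _)).ennreal_ofReal
  set F : CoeffClass p l β L → Design p K n × Responses K n → ℝ≥0∞ :=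
    fun θ x => ∫⁻ t, lossA A u₀ θ t ∂(κ x) with hF
  have hFmeas : ∀ θ, Measurable (F θ) := fun θ => (hmeas θ).lintegral_kernel
  have hFsum : ∀ x, Δ ≤ F θ₀ x + F θ₁ x := by
    intro x
    rw [hF]
    simp only
    rw [← lintegral_add_left (hmeas θ₀)]
    calc Δ = ∫⁻ _, Δ ∂(κ x) := by simp
      _ ≤ _ := lintegral_mono hsum
  have hmean₀ : ∀ d, responseMean (K := K) (n := n) u₀ θ₀.1 d = 0 := by
    intro d; ext k i; simp [responseMean, hθ₀]
  have hR₀ := lintegral_comp_dataLaw (n := n) A u₀ D κ θ₀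
  have hR₁ := lintegral_comp_dataLaw (n := n) A u₀ D κ θ₁
  simp only [hmean₀, zero_add] at hR₀
  set R := ⨆ θ, ∫⁻ t, lossA A u₀ θ t ∂((κ ∘ₖ dataLaw l β L u₀ D) θ)
  set q : ℝ≥0∞ := Δ * (ENNReal.ofReal (Real.exp (-s / 2)) * 2⁻¹) with hq
  have hkey : q * 2⁻¹ ≤ R * 2 := by
    calc q * 2⁻¹ ≤ q * D G := by gcongr
      _ = ∫⁻ _ in G, q ∂D := by rw [setLIntegral_const]
      _ ≤ ∫⁻ d in G, ((∫⁻ y, F θ₀ (d, y) ∂(noiseLaw K n)) +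
            ∫⁻ y, F θ₁ (d, responseMean u₀ θ₁.1 d + y) ∂(noiseLaw K n)) ∂D := by
          refine lintegral_mono_ae ?_
          filter_upwards [ae_restrict_of_ae hs, ae_restrict_mem hG] with d hd hdG
          exact le_lintegral_add_lintegral_shift _ (hd hdG)
            ((hFmeas θ₁).comp measurable_prodMk_left) fun y => hFsum (d, y)
      _ ≤ ∫⁻ d, ((∫⁻ y, F θ₀ (d, y) ∂(noiseLaw K n)) +
            ∫⁻ y, F θ₁ (d, responseMean u₀ θ₁.1 d + y) ∂(noiseLaw K n)) ∂D :=
          setLIntegral_le_lintegral _ _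
      _ = (∫⁻ t, lossA A u₀ θ₀ t ∂((κ ∘ₖ dataLaw l β L u₀ D) θ₀)) +
            ∫⁻ t, lossA A u₀ θ₁ t ∂((κ ∘ₖ dataLaw l β L u₀ D) θ₁) := by
          rw [hR₀, hR₁, ← lintegral_add_left (hFmeas θ₀).lintegral_prod_right']
      _ ≤ R + R := add_le_add (le_iSup (fun θ => ∫⁻ t, lossA A u₀ θ t
            ∂((κ ∘ₖ dataLaw l β L u₀ D) θ)) θ₀) (le_iSup (fun θ => ∫⁻ t, lossA A u₀ θ t
            ∂((κ ∘ₖ dataLaw l β L u₀ D) θ)) θ₁)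
      _ = R * 2 := (mul_two R).symm
  have hhalf : (2⁻¹ : ℝ≥0∞) = ENNReal.ofReal (1 / 2) := by
    rw [one_div, ENNReal.ofReal_inv_of_pos two_pos, ENNReal.ofReal_ofNat]
  have hfin : ENNReal.ofReal (Real.exp (-s / 2) / 16 * sqNormA A fun j => θ₁.1 j u₀) =
      q * 2⁻¹ / 2 := by
    rw [ENNReal.div_eq_inv_mul, hq, hΔ, hhalf, ← ENNReal.ofReal_mul (by positivity),
      ← ENNReal.ofReal_mul' (by positivity), ← ENNReal.ofReal_mul' (by positivity),
      ← ENNReal.ofReal_mul (by positivity)]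
    congr 1
    ring
  rw [hfin]
  exact ENNReal.div_le_of_le_mul hkey

/-- The two-point bound along an eigenvector `v` of `A`: the hypotheses are `θ = 0` and `θ = v g`. As
`|X_{ki}ᵀ v| ≤ 1`, observation `(k, i)` contributes at most `g(U_k)²` to the squared distance of the
mean responses. -/
lemma le_minimaxRisk_of_eigenvalue {A : Matrix (Fin p) (Fin p) ℝ} (hA : A.PosSemidef) (j₀ : Fin p)
    (u₀ : ℝ) (D : Measure (Design p K n)) [IsProbabilityMeasure D]
    (hX : ∀ᵐ d ∂D, ∀ k i, ‖d.2 k i‖ ≤ 1) {g : ℝ → ℝ}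
    (hg : ∀ c : ℝ, |c| ≤ 1 → IsHolder l β L fun u => c * g u) {G : Set (Design p K n)}
    (hG : MeasurableSet G) (hDG : 2⁻¹ ≤ D G) {s : ℝ}
    (hs : ∀ d ∈ G, ∑ k, n k * g (domainIndex u₀ d.1 k) ^ 2 ≤ s) :
    ENNReal.ofReal (Real.exp (-s / 2) / 16 * (hA.isHermitian.eigenvalues j₀ * g u₀ ^ 2)) ≤
      minimaxRisk (lossA A u₀) (dataLaw l β L u₀ D) := by
  set v : EuclideanSpace ℝ (Fin p) := hA.isHermitian.eigenvectorBasis j₀ with hv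
  have hv1 : ‖v‖ = 1 := hA.isHermitian.eigenvectorBasis.orthonormal.1 j₀
  have hvj : ∀ j, |v j| ≤ 1 := fun j => by
    simpa [hv1] using PiLp.norm_apply_le v j
  let θ₀ : CoeffClass p l β L := ⟨fun _ _ => 0, fun _ => by simpa using hg 0 (by simp)⟩
  let θ₁ : CoeffClass p l β L := ⟨fun j u => v j * g u, fun j => hg _ (hvj j)⟩
  have hnorm : sqNormA A (fun j => θ₁.1 j u₀) = hA.isHermitian.eigenvalues j₀ * g u₀ ^ 2 := by
    have he := hA.isHermitian.eigenvalues_eq j₀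
    have h1 : (fun j => θ₁.1 j u₀) = g u₀ • (v : Fin p → ℝ) := by
      ext j; simp [θ₁, mul_comm]
    rw [h1, he]
    simp only [sqNormA, Matrix.mulVec_smul, dotProduct_smul, smul_dotProduct, smul_eq_mul,
      star_trivial, RCLike.re_to_real]
    ring
  rw [← hnorm]
  refine le_minimaxRisk_of_two_points hA u₀ D θ₀ θ₁ (fun _ _ => rfl) hG hDG (s := s) ?_
  filter_upwards [hX] with d hd hdG
  refine le_trans (Finset.sum_le_sum fun k _ => ?_) (hs d hdG)
  calc ∑ i, responseMean u₀ θ₁.1 d k i ^ 2 ≤ ∑ _i : Fin (n k), g (domainIndex u₀ d.1 k) ^ 2 := by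
        refine Finset.sum_le_sum fun i _ => ?_
        have hm : responseMean u₀ θ₁.1 d k i = inner ℝ (d.2 k i) v * g (domainIndex u₀ d.1 k) := by
          simp only [responseMean, θ₁, PiLp.inner_apply, Finset.sum_mul]
          refine Finset.sum_congr rfl fun j _ => ?_
          simp
          ring
        have hin : |inner ℝ (d.2 k i) v| ≤ 1 := by
          refine (abs_real_inner_le_norm _ _).trans ?_
          rw [hv1, mul_one]
          exact hd k i
        rw [hm, mul_pow]
        exact mul_le_of_le_one_left (sq_nonneg _) ((sq_le_one_iff_abs_le_one _).2 hin)
    _ = _ := by simp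

/-! ### Hölder bumps -/

lemma isHolder_const (l : ℕ) (β : ℝ) {L : ℝ} (hL : 0 ≤ L) (c : ℝ) : IsHolder l β L fun _ => c := by
  refine ⟨contDiff_const, fun u u' => ?_⟩
  simp only [iteratedDeriv_const, sub_self, abs_zero]
  positivity

/-- Rescaling a Hölder function to width `h` and amplitude `a` multiplies its Hölder constant by
`|a| h ^ (-β)`. -/
lemma IsHolder.rescale {M : ℝ} {φ : ℝ → ℝ} (hφ : IsHolder l β M φ) (u₀ : ℝ) {a h : ℝ}
    (hh : 0 < h) (ha : |a| * M ≤ L * h ^ β) :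
    IsHolder l β L fun u => a * φ ((u - u₀) / h) := by
  have hfun : (fun u => a * φ ((u - u₀) / h)) = fun u => a * (fun x => φ (h⁻¹ * x)) (u - u₀) := by
    ext u; simp only [div_eq_inv_mul]
  have hcd : ContDiff ℝ l fun x => φ (h⁻¹ * x) := hφ.1.comp (contDiff_const.mul contDiff_id)
  have hcd' : ContDiff ℝ l fun u => φ (h⁻¹ * (u - u₀)) := hcd.comp (contDiff_id.sub contDiff_const)
  have hder : ∀ u, iteratedDeriv l (fun u => a * φ ((u - u₀) / h)) u =
      a * ((h⁻¹) ^ l * iteratedDeriv l φ (h⁻¹ * (u - u₀))) := by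
    intro u
    rw [hfun, iteratedDeriv_const_mul a (hcd'.contDiffAt)]
    have h2 := congrFun (iteratedDeriv_comp_sub_const l (fun x => φ (h⁻¹ * x)) u₀) u
    rw [h2, iteratedDeriv_comp_const_mul hφ.1]
  refine ⟨by rw [hfun]; exact contDiff_const.mul hcd', fun u u' => ?_⟩
  rw [hder, hder, ← mul_sub, ← mul_sub, abs_mul, abs_mul, abs_of_pos (by positivity : 0 < h⁻¹ ^ l)]
  have h1 := hφ.2 (h⁻¹ * (u - u₀)) (h⁻¹ * (u' - u₀))
  have h2 : |h⁻¹ * (u - u₀) - h⁻¹ * (u' - u₀)| = h⁻¹ * |u - u'| := by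
    rw [← mul_sub, abs_mul, abs_of_pos (inv_pos.2 hh)]
    congr 2
    ring
  rw [h2, Real.mul_rpow (by positivity) (abs_nonneg _)] at h1
  have h3 : h⁻¹ ^ l * h⁻¹ ^ (β - l) = (h ^ β)⁻¹ := by
    rw [← Real.rpow_natCast, ← Real.rpow_add (inv_pos.2 hh), add_sub_cancel, Real.inv_rpow hh.le]
  have hpos : 0 < h ^ β := by positivity
  calc |a| * (h⁻¹ ^ l * |iteratedDeriv l φ (h⁻¹ * (u - u₀)) - iteratedDeriv l φ (h⁻¹ * (u' - u₀))|)
      ≤ |a| * (h⁻¹ ^ l * (M * (h⁻¹ ^ (β - l) * |u - u'| ^ (β - l)))) := by gcongr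
    _ = (|a| * M) * (h⁻¹ ^ l * h⁻¹ ^ (β - l)) * |u - u'| ^ (β - l) := by ring
    _ ≤ (L * h ^ β) * (h⁻¹ ^ l * h⁻¹ ^ (β - l)) * |u - u'| ^ (β - l) := by gcongr
    _ = L * |u - u'| ^ (β - l) := by
      rw [h3, mul_assoc L, mul_inv_cancel₀ hpos.ne', mul_one]

/-- There is a Hölder bump supported in `[-1, 1]`. For a smooth compactly supported function the
`l`-th derivative is bounded and Lipschitz, hence Hölder with every exponent `β - l ∈ [0, 1]`. -/
lemma exists_isHolder_bump (hlβ : (l : ℝ) ≤ β) (hβl : β ≤ (l : ℝ) + 1) :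
    ∃ (φ : ℝ → ℝ) (M : ℝ), 0 < M ∧ IsHolder l β M φ ∧ φ 0 = 1 ∧ (∀ x, 0 ≤ φ x) ∧
      (∀ x, φ x ≤ 1) ∧ ∀ x, 1 ≤ |x| → φ x = 0 := by
  let b : ContDiffBump (0 : ℝ) := ⟨1 / 2, 1, by norm_num, by norm_num⟩
  have hb : ContDiff ℝ (⊤ : ℕ∞) b := b.contDiff
  have hsupp : HasCompactSupport (iteratedDeriv l b) := by
    clear hlβ hβl
    induction l with
    | zero => simpa using b.hasCompactSupport
    | succ m ih => rw [iteratedDeriv_succ]; exact ih.deriv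
  have hder : ContDiff ℝ 1 (iteratedDeriv l b) := by
    have h : ContDiff ℝ ((1 + l : ℕ) : WithTop ℕ∞) b := hb.of_le (by exact_mod_cast le_top)
    rw [iteratedDeriv_eq_iterate]
    exact ContDiff.iterate_deriv' 1 l h
  obtain ⟨B, hB⟩ := hsupp.exists_bound_of_continuous hder.continuous
  obtain ⟨C, hC⟩ := hder.lipschitzWith_of_hasCompactSupport hsupp one_ne_zero
  have hB0 : 0 ≤ B := (norm_nonneg _).trans (hB 0)
  refine ⟨b, 2 * B + C + 1, by positivity, ⟨hb.of_le (by exact_mod_cast le_top), fun u u' => ?_⟩,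
    b.one_of_mem_closedBall (by simp [b]), fun x => b.nonneg, fun x => b.le_one, fun x hx =>
    b.zero_of_le_dist (by simpa [b] using hx)⟩
  rcases eq_or_ne u u' with rfl | hne
  · simp only [sub_self, abs_zero]
    positivity
  have hx : 0 < |u - u'| := abs_pos.2 (sub_ne_zero.2 hne)
  rcases le_total |u - u'| 1 with h1 | h1
  · -- Close points: the Lipschitz bound, as `β - l ≤ 1`.
    have h2 : |u - u'| ≤ |u - u'| ^ (β - l) := by
      simpa using Real.rpow_le_rpow_of_exponent_ge hx h1 (by linarith : β - l ≤ 1)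
    have h3 := hC.dist_le_mul u u'
    rw [Real.dist_eq, Real.dist_eq] at h3
    calc _ ≤ C * |u - u'| := h3
      _ ≤ (2 * B + C + 1) * |u - u'| ^ (β - l) := by
        gcongr
        linarith
  · -- Distant points: the sup bound, as `β - l ≥ 0`.
    have h2 : 1 ≤ |u - u'| ^ (β - l) := Real.one_le_rpow h1 (by linarith)
    have h3 : |iteratedDeriv l b u - iteratedDeriv l b u'| ≤ B + B :=
      (abs_sub _ _).trans (add_le_add (hB u) (hB u'))
    calc _ ≤ (2 * B + C + 1) * 1 := by linarith [C.2]
      _ ≤ (2 * B + C + 1) * |u - u'| ^ (β - l) := by gcongr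

/-! ### The law of the source indices -/

lemma isProbabilityMeasure_sourceLaw {f : ℝ → ℝ} (hf : Measurable f)
    (hf1 : ∫⁻ t, ENNReal.ofReal (f t) = 1) {γ : ℝ} (hγ : 0 < γ) (uStar : ℝ) :
    IsProbabilityMeasure (sourceLaw f uStar γ) := by
  constructor
  rw [sourceLaw, withDensity_apply _ .univ, Measure.restrict_univ,
    lintegral_sub_right_eq_self (fun u => ENNReal.ofReal (γ⁻¹ * f (u / γ)))]
  simp_rw [ENNReal.ofReal_mul (inv_nonneg.2 hγ.le), div_eq_mul_inv]
  rw [lintegral_const_mul _ (by fun_prop)]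
  have hmap := Real.map_volume_mul_right (inv_ne_zero hγ.ne')
  rw [← lintegral_map (f := fun t => ENNReal.ofReal (f t)) (g := fun u => u * γ⁻¹) (by fun_prop)
    (by fun_prop), hmap, lintegral_smul_measure, hf1, inv_inv, abs_of_pos hγ, smul_eq_mul, mul_one,
    ← ENNReal.ofReal_mul (inv_nonneg.2 hγ.le), inv_mul_cancel₀ hγ.ne', ENNReal.ofReal_one]

lemma sourceLaw_closedBall_le {f : ℝ → ℝ} {a₀ : ℝ} (hf : ∀ t, f t ≤ a₀) (ha₀ : 0 ≤ a₀) {γ : ℝ}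
    (hγ : 0 < γ) (uStar u₀ h : ℝ) :
    sourceLaw f uStar γ (Metric.closedBall u₀ h) ≤ ENNReal.ofReal (2 * a₀ * h / γ) := by
  rw [sourceLaw, withDensity_apply _ Metric.isClosed_closedBall.measurableSet]
  calc _ ≤ ∫⁻ _ in Metric.closedBall u₀ h, ENNReal.ofReal (γ⁻¹ * a₀) := by
        gcongr with u
        exact hf _
    _ = ENNReal.ofReal (2 * a₀ * h / γ) := by
        rw [setLIntegral_const, Real.volume_closedBall, ← ENNReal.ofReal_mul (by positivity)]
        congr 1
        ring

section Admissible

variable {f : ℝ → ℝ} {a₀ γ uStar : ℝ} {D : Measure (Design p K n)}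

lemma IsAdmissibleDesign.isProbabilityMeasure (hD : IsAdmissibleDesign f uStar γ D)
    (hS : IsProbabilityMeasure (sourceLaw f uStar γ)) : IsProbabilityMeasure D := by
  have h : IsProbabilityMeasure (D.map Prod.fst) := by rw [hD.indices]; infer_instance
  exact (Measure.isProbabilityMeasure_map_iff measurable_fst.aemeasurable).1 h

lemma IsAdmissibleDesign.measure_index_mem (hD : IsAdmissibleDesign f uStar γ D)
    (hS : IsProbabilityMeasure (sourceLaw f uStar γ)) (k : Fin K) {B : Set ℝ}
    (hB : MeasurableSet B) : D {d | d.1 k ∈ B} = sourceLaw f uStar γ B := by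
  have h1 : {d : Design p K n | d.1 k ∈ B} = Prod.fst ⁻¹' (Function.eval k ⁻¹' B) := rfl
  rw [h1, ← Measure.map_apply measurable_fst (measurable_pi_apply k hB), hD.indices]
  exact (measurePreserving_eval (fun _ : Fin K => sourceLaw f uStar γ) k).measure_preimage
    hB.nullMeasurableSet

end Admissible

/-- If a measurable event fails with probability at most one half, it has probability at least one
half. -/
lemma inv_two_le_measure_of_compl_le {Ω : Type*} [MeasurableSpace Ω] {P : Measure Ω}
    [IsProbabilityMeasure P] {G : Set Ω} (hG : MeasurableSet G) (h : P Gᶜ ≤ 2⁻¹) : 2⁻¹ ≤ P G := by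
  rw [← compl_compl G, prob_compl_eq_one_sub hG.compl]
  calc (2⁻¹ : ℝ≥0∞) = 1 - 2⁻¹ := ENNReal.one_sub_inv_two.symm
    _ ≤ 1 - P Gᶜ := tsub_le_tsub_left h 1

/-! ### Bump hypotheses and the choice of the width -/

/-- The two-point bound with a bump of width `h` at `u₀`. Its amplitude is the smaller of `n₀^(-1/2)`,
so that the target sample contributes at most one to the squared distance, and `(L / M) h ^ β`,
with which the rescaled bump stays in the Hölder class. The contribution of the source domains is at most `τ` on `G`. -/
lemma le_minimaxRisk_of_bump {A : Matrix (Fin p) (Fin p) ℝ} (hA : A.PosSemidef) (j₀ : Fin p)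
    (u₀ : ℝ) (D : Measure (Design p K n)) [IsProbabilityMeasure D]
    (hX : ∀ᵐ d ∂D, ∀ k i, ‖d.2 k i‖ ≤ 1) (hn : 1 ≤ n 0) (hL : 0 < L) {φ : ℝ → ℝ} {M : ℝ}
    (hM : 0 < M) (hφ : IsHolder l β M φ) (hφ0 : φ 0 = 1) (hφn : ∀ x, 0 ≤ φ x) (hφ1 : ∀ x, φ x ≤ 1)
    (hφs : ∀ x, 1 ≤ |x| → φ x = 0) {h : ℝ} (hh : 0 < h) {G : Set (Design p K n)}
    (hG : MeasurableSet G) (hDG : 2⁻¹ ≤ D G) {τ : ℝ}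
    (hτ : ∀ d ∈ G, ∑ k : Fin K, n k.succ *
      ((L / M) ^ 2 * h ^ (2 * β) * (Metric.closedBall u₀ h).indicator 1 (d.1 k)) ≤ τ) :
    ENNReal.ofReal (Real.exp (-(1 + τ) / 2) / 16 * (hA.isHermitian.eigenvalues j₀ *
        (min 1 ((L / M) ^ 2) * min ((n 0 : ℝ)⁻¹) (h ^ (2 * β))))) ≤
      minimaxRisk (lossA A u₀) (dataLaw l β L u₀ D) := by
  have hn0 : (0 : ℝ) < n 0 := by exact_mod_cast hn
  have hq : 0 < L / M := div_pos hL hM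
  have hhβ : 0 < h ^ β := by positivity
  have hsq : (h ^ β) ^ 2 = h ^ (2 * β) := by
    rw [← Real.rpow_natCast, ← Real.rpow_mul hh.le, mul_comm]; norm_num
  set a : ℝ := min (√((n 0 : ℝ)⁻¹)) (L / M * h ^ β) with ha
  have ha0 : 0 ≤ a := le_min (Real.sqrt_nonneg _) (by positivity)
  have han : a ^ 2 ≤ (n 0 : ℝ)⁻¹ := by
    calc a ^ 2 ≤ √((n 0 : ℝ)⁻¹) ^ 2 := by gcongr; exact min_le_left _ _
      _ = _ := Real.sq_sqrt (by positivity)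
  have haL : a ^ 2 ≤ (L / M) ^ 2 * h ^ (2 * β) := by
    calc a ^ 2 ≤ (L / M * h ^ β) ^ 2 := by gcongr; exact min_le_right _ _
      _ = _ := by rw [mul_pow, hsq]
  have hlow : min 1 ((L / M) ^ 2) * min ((n 0 : ℝ)⁻¹) (h ^ (2 * β)) ≤ a ^ 2 := by
    have hm0 : 0 ≤ min ((n 0 : ℝ)⁻¹) (h ^ (2 * β)) := le_min (by positivity) (by positivity)
    rcases min_choice (√((n 0 : ℝ)⁻¹)) (L / M * h ^ β) with hc | hc
    · rw [ha, hc, Real.sq_sqrt (by positivity)]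
      calc _ ≤ 1 * (n 0 : ℝ)⁻¹ := by
            gcongr
            · exact min_le_left _ _
            · exact min_le_left _ _
        _ = _ := one_mul _
    · rw [ha, hc, mul_pow, hsq]
      gcongr
      · exact min_le_right _ _
      · exact min_le_right _ _
  set g : ℝ → ℝ := fun u => a * φ ((u - u₀) / h) with hg
  have hg0 : g u₀ = a := by simp [hg, hφ0]
  have hholder : ∀ c : ℝ, |c| ≤ 1 → IsHolder l β L fun u => c * g u := by
    intro c hc
    have hca : |c * a| * M ≤ L * h ^ β := by
      rw [abs_mul, abs_of_nonneg ha0]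
      calc |c| * a * M ≤ 1 * (L / M * h ^ β) * M := by gcongr; exact min_le_right _ _
        _ = L * h ^ β := by field_simp
    simpa only [hg, mul_assoc] using hφ.rescale u₀ hh hca
  have hgsq : ∀ u, g u ^ 2 ≤
      (L / M) ^ 2 * h ^ (2 * β) * (Metric.closedBall u₀ h).indicator 1 u := by
    intro u
    by_cases hu : u ∈ Metric.closedBall u₀ h
    · rw [Set.indicator_of_mem hu, Pi.one_apply, mul_one]
      refine le_trans ?_ haL
      rw [hg, mul_pow]
      exact mul_le_of_le_one_right (sq_nonneg _) (pow_le_one₀ (hφn _) (hφ1 _))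
    · rw [Set.indicator_of_notMem hu, mul_zero]
      have h1 : φ ((u - u₀) / h) = 0 := by
        refine hφs _ ?_
        rw [abs_div, abs_of_pos hh, one_le_div hh]
        rw [Metric.mem_closedBall, Real.dist_eq, not_le] at hu
        exact hu.le
      simp [hg, h1]
  refine le_trans (ENNReal.ofReal_le_ofReal ?_)
    (le_minimaxRisk_of_eigenvalue hA j₀ u₀ D hX hholder hG hDG (s := 1 + τ) ?_)
  · rw [hg0]
    have := hA.eigenvalues_nonneg j₀
    gcongr
  · intro d hd
    rw [Fin.sum_univ_succ]
    refine add_le_add ?_ (le_trans (Finset.sum_le_sum fun k _ => ?_) (hτ d hd))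
    · simp only [domainIndex, Fin.cons_zero, hg0]
      calc (n 0 : ℝ) * a ^ 2 ≤ n 0 * (n 0 : ℝ)⁻¹ := by gcongr
        _ = 1 := mul_inv_cancel₀ hn0.ne'
    · simp only [domainIndex, Fin.cons_succ]
      gcongr
      exact hgsq _

section Rates

variable {f : ℝ → ℝ} {a₀ γ uStar : ℝ}

/-- With probability at least one half no source index falls into a ball of radius
`γ / (4 a₀ K)`. -/
lemma inv_two_le_measure_forall_notMem (ha₀ : 0 < a₀) (hγ : 0 < γ) (hK : 1 ≤ K)
    (hfa : ∀ t, f t ≤ a₀) (hS : IsProbabilityMeasure (sourceLaw f uStar γ))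
    (D : Measure (Design p K n)) [IsProbabilityMeasure D] (hD : IsAdmissibleDesign f uStar γ D)
    (u₀ : ℝ) : MeasurableSet {d : Design p K n | ∀ k, d.1 k ∉ Metric.closedBall u₀
        ((4 * a₀)⁻¹ * ((K : ℝ) / γ)⁻¹)} ∧
      2⁻¹ ≤ D {d | ∀ k, d.1 k ∉ Metric.closedBall u₀ ((4 * a₀)⁻¹ * ((K : ℝ) / γ)⁻¹)} := by
  set h : ℝ := (4 * a₀)⁻¹ * ((K : ℝ) / γ)⁻¹ with hh
  have hK0 : (0 : ℝ) < K := by exact_mod_cast hK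
  have hB : MeasurableSet (Metric.closedBall u₀ h) := Metric.isClosed_closedBall.measurableSet
  have hG : MeasurableSet {d : Design p K n | ∀ k, d.1 k ∉ Metric.closedBall u₀ h} := by
    rw [Set.ofPred_forall]
    exact MeasurableSet.iInter fun k =>
      (hB.compl.preimage ((measurable_pi_apply k).comp measurable_fst))
  refine ⟨hG, inv_two_le_measure_of_compl_le hG ?_⟩
  have hc : {d : Design p K n | ∀ k, d.1 k ∉ Metric.closedBall u₀ h}ᶜ =
      ⋃ k, {d | d.1 k ∈ Metric.closedBall u₀ h} := by
    ext d; simp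
  rw [hc]
  calc _ ≤ ∑ k, D {d | d.1 k ∈ Metric.closedBall u₀ h} := measure_iUnion_fintype_le _ _
    _ ≤ ∑ _k : Fin K, ENNReal.ofReal (2 * a₀ * h / γ) := Finset.sum_le_sum fun k _ => by
        rw [hD.measure_index_mem hS k hB]
        exact sourceLaw_closedBall_le hfa ha₀.le hγ uStar u₀ h
    _ = ENNReal.ofReal (1 / 2) := by
        rw [Finset.sum_const, Finset.card_univ, Fintype.card_fin, nsmul_eq_mul,
          ← ENNReal.ofReal_natCast, ← ENNReal.ofReal_mul (by positivity)]
        congr 1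
        rw [hh]
        field_simp
        norm_num
    _ ≤ 2⁻¹ := by rw [one_div, ENNReal.ofReal_inv_of_pos two_pos, ENNReal.ofReal_ofNat]

/-- If `h ^ (2β + 1) ≤ γ / N`, the contribution of the source domains to the squared distance of
the mean responses is bounded in expectation, so it is bounded with probability at least one half by
Markov's inequality. -/
lemma inv_two_le_measure_sum_indicator_le (ha₀ : 0 < a₀) (hγ : 0 < γ)
    (hfa : ∀ t, f t ≤ a₀) (hS : IsProbabilityMeasure (sourceLaw f uStar γ))
    (D : Measure (Design p K n)) [IsProbabilityMeasure D] (hD : IsAdmissibleDesign f uStar γ D)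
    (u₀ : ℝ) {q h : ℝ} (hq : 0 < q) (hh : 0 < h)
    (hN : h ^ (2 * β) * h * (((∑ k, n k : ℕ) : ℝ) / γ) ≤ 1) :
    MeasurableSet {d : Design p K n | ∑ k : Fin K, n k.succ *
        (q * h ^ (2 * β) * (Metric.closedBall u₀ h).indicator 1 (d.1 k)) ≤ 4 * a₀ * q} ∧
      2⁻¹ ≤ D {d | ∑ k : Fin K, n k.succ *
        (q * h ^ (2 * β) * (Metric.closedBall u₀ h).indicator 1 (d.1 k)) ≤ 4 * a₀ * q} := by
  have hB : MeasurableSet (Metric.closedBall u₀ h) := Metric.isClosed_closedBall.measurableSet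
  set Z : Design p K n → ℝ := fun d => ∑ k : Fin K, n k.succ *
    (q * h ^ (2 * β) * (Metric.closedBall u₀ h).indicator 1 (d.1 k)) with hZ
  have hind : Measurable ((Metric.closedBall u₀ h).indicator (1 : ℝ → ℝ)) :=
    measurable_one.indicator hB
  have hind0 : ∀ u, 0 ≤ (Metric.closedBall u₀ h).indicator (1 : ℝ → ℝ) u :=
    fun u => Set.indicator_nonneg (fun _ _ => zero_le_one) u
  have hZm : Measurable Z := Finset.measurable_sum _ fun k _ =>
    ((hind.comp ((measurable_pi_apply k).comp measurable_fst)).const_mul _).const_mul _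
  have hG : MeasurableSet {d | Z d ≤ 4 * a₀ * q} := measurableSet_le hZm measurable_const
  refine ⟨hG, inv_two_le_measure_of_compl_le hG ?_⟩
  have hsub : {d | Z d ≤ 4 * a₀ * q}ᶜ ⊆
      {d | ENNReal.ofReal (4 * a₀ * q) ≤ ENNReal.ofReal (Z d)} := by
    intro d hd
    simp only [Set.mem_compl_iff, Set.mem_ofPred_eq, not_le] at hd
    exact ENNReal.ofReal_le_ofReal hd.le
  have hexp : ∫⁻ d, ENNReal.ofReal (Z d) ∂D ≤ ENNReal.ofReal (2 * a₀ * q) := by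
    have h1 : ∀ d, ENNReal.ofReal (Z d) = ∑ k : Fin K, ENNReal.ofReal (n k.succ * (q * h ^ (2 * β))) *
        {d : Design p K n | d.1 k ∈ Metric.closedBall u₀ h}.indicator 1 d := by
      intro d
      rw [hZ, ENNReal.ofReal_sum_of_nonneg fun k _ => by have := hind0 (d.1 k); positivity]
      refine Finset.sum_congr rfl fun k _ => ?_
      rw [← mul_assoc, ENNReal.ofReal_mul (by positivity)]
      congr 1
      by_cases hd : d.1 k ∈ Metric.closedBall u₀ h
      · rw [Set.indicator_of_mem hd, Set.indicator_of_mem (by exact hd)]; simp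
      · rw [Set.indicator_of_notMem hd, Set.indicator_of_notMem (by exact hd)]; simp
    have hBk : ∀ k, MeasurableSet {d : Design p K n | d.1 k ∈ Metric.closedBall u₀ h} :=
      fun k => hB.preimage ((measurable_pi_apply k).comp measurable_fst)
    simp_rw [h1]
    rw [lintegral_finsetSum _ fun k _ => (measurable_one.indicator (hBk k)).const_mul _]
    calc _ ≤ ∑ k : Fin K, ENNReal.ofReal (n k.succ * (q * h ^ (2 * β))) *
            ENNReal.ofReal (2 * a₀ * h / γ) := by
          refine Finset.sum_le_sum fun k _ => ?_
          rw [lintegral_const_mul _ (measurable_one.indicator (hBk k)),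
            lintegral_indicator_one (hBk k), hD.measure_index_mem hS k hB]
          gcongr
          exact sourceLaw_closedBall_le hfa ha₀.le hγ uStar u₀ h
      _ = ENNReal.ofReal (∑ k : Fin K, n k.succ * (q * h ^ (2 * β)) * (2 * a₀ * h / γ)) := by
          rw [ENNReal.ofReal_sum_of_nonneg fun k _ => by positivity]
          exact Finset.sum_congr rfl fun k _ => (ENNReal.ofReal_mul (by positivity)).symm
      _ ≤ _ := by
          refine ENNReal.ofReal_le_ofReal ?_
          rw [← Finset.sum_mul, ← Finset.sum_mul]
          have hle : ∑ k : Fin K, (n k.succ : ℝ) ≤ ((∑ k, n k : ℕ) : ℝ) := by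
            rw [Fin.sum_univ_succ]; push_cast; linarith [(n 0).cast_nonneg (α := ℝ)]
          calc (∑ k : Fin K, (n k.succ : ℝ)) * (q * h ^ (2 * β)) * (2 * a₀ * h / γ)
              ≤ ((∑ k, n k : ℕ) : ℝ) * (q * h ^ (2 * β)) * (2 * a₀ * h / γ) := by gcongr
            _ = 2 * a₀ * q * (h ^ (2 * β) * h * (((∑ k, n k : ℕ) : ℝ) / γ)) := by ring
            _ ≤ 2 * a₀ * q := mul_le_of_le_one_right (by positivity) hN
  have hpos : 0 < 4 * a₀ * q := by positivity
  calc D {d | Z d ≤ 4 * a₀ * q}ᶜ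
      ≤ D {d | ENNReal.ofReal (4 * a₀ * q) ≤ ENNReal.ofReal (Z d)} := measure_mono hsub
    _ ≤ (∫⁻ d, ENNReal.ofReal (Z d) ∂D) / ENNReal.ofReal (4 * a₀ * q) :=
        meas_ge_le_lintegral_div hZm.ennreal_ofReal.aemeasurable (by simpa using hpos)
          ENNReal.ofReal_ne_top
    _ ≤ ENNReal.ofReal (2 * a₀ * q) / ENNReal.ofReal (4 * a₀ * q) := by gcongr
    _ = ENNReal.ofReal (1 / 2) := by
        rw [← ENNReal.ofReal_div_of_pos hpos]
        congr 1
        field_simp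
        norm_num
    _ ≤ 2⁻¹ := by rw [one_div, ENNReal.ofReal_inv_of_pos two_pos, ENNReal.ofReal_ofNat]

end Rates

end LowerBound

/-! ### The minimax lower bound -/

theorem mainTheorem2 (l : ℕ) (β L a₀ : ℝ) (hβ : 0 < β) (hlβ : (l : ℝ) ≤ β) (hβl : β ≤ (l : ℝ) + 1)
    (hL : 0 < L) (ha₀ : 0 < a₀) :
    ∃ c : ℝ, 0 < c ∧
      ∀ (p : ℕ) (A : Matrix (Fin p) (Fin p) ℝ) (hA : A.PosSemidef)
        (K : ℕ) (_ : 1 ≤ K) (n : Fin (K + 1) → ℕ) (_ : 1 ≤ n 0)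
        (γ : ℝ) (_ : 0 < γ) (u₀ uStar : ℝ)
        (f : ℝ → ℝ) (_ : Measurable f) (_ : ∀ t, 0 ≤ f t) (_ : ∀ t, f t ≤ a₀)
        (_ : ∫⁻ t, ENNReal.ofReal (f t) = 1)
        (D : Measure (Design p K n)) (_ : IsAdmissibleDesign f uStar γ D),
        ENNReal.ofReal (c * (⨆ j, hA.isHermitian.eigenvalues j) * tlRate β γ n) ≤
          minimaxRisk (lossA A u₀) (dataLaw l β L u₀ D) := by
  obtain ⟨φ, M, hM, hφ, hφ0, hφn, hφ1, hφs⟩ := exists_isHolder_bump hlβ hβl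
  set q : ℝ := (L / M) ^ 2 with hq
  have hq0 : 0 < q := by positivity
  set e : ℝ := Real.exp (-(1 + 4 * a₀ * q) / 2) / 16 with he
  set r : ℝ := (4 * a₀)⁻¹ ^ (2 * β) with hr
  have hr0 : 0 < r := by positivity
  refine ⟨e * (min 1 q * min 1 r), by positivity, ?_⟩
  intro p A hA K hK n hn γ hγ u₀ uStar f hf _ hfa hf1 D hD
  have hS := isProbabilityMeasure_sourceLaw hf hf1 hγ uStar
  have hDP := hD.isProbabilityMeasure hS
  -- Without coordinates the supremum of the eigenvalues is the junk value zero.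
  rcases isEmpty_or_nonempty (Fin p) with hp | hp
  · simp [Real.iSup_of_isEmpty]
  obtain ⟨j₀, hj₀⟩ := exists_eq_ciSup_of_finite (f := hA.isHermitian.eigenvalues)
  rw [← hj₀]
  set Λ := hA.isHermitian.eigenvalues j₀
  have hΛ : 0 ≤ Λ := hA.eigenvalues_nonneg j₀
  have hK0 : (0 : ℝ) < K := by exact_mod_cast hK
  have hN0' : 0 < ∑ k, n k :=
    lt_of_lt_of_le hn (Finset.single_le_sum (f := n) (fun _ _ => Nat.zero_le _) (Finset.mem_univ 0))
  have hN0 : (0 : ℝ) < ((∑ k, n k : ℕ) : ℝ) := by exact_mod_cast hN0'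
  have hm : min 1 q * min 1 r ≤ 1 :=
    mul_le_one₀ (min_le_left _ _) (by positivity) (min_le_left _ _)
  -- The exponential factor of each of the three bounds is at least `e`.
  have hexp : ∀ τ, τ ≤ 4 * a₀ * q → e ≤ Real.exp (-(1 + τ) / 2) / 16 := by
    intro τ hτ
    rw [he]
    gcongr
  have h0 : (0 : ℝ) ≤ 4 * a₀ * q := by positivity
  unfold tlRate
  set R₁ := ((K : ℝ) / γ) ^ (-(2 * β)) with hR₁
  set R₂ := (((∑ k, n k : ℕ) : ℝ) / γ) ^ (-(2 * β) / (2 * β + 1)) with hR₂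
  have hR₁0 : 0 < R₁ := by positivity
  have hR₂0 : 0 < R₂ := by positivity
  rcases max_choice R₁ (max R₂ (((∑ k, n k : ℕ) : ℝ)⁻¹)) with hmax | hmax
  · -- The bump so narrow that it probably contains no source index.
    rw [hmax]
    have hb := inv_two_le_measure_forall_notMem ha₀ hγ hK hfa hS D hD u₀
    set h : ℝ := (4 * a₀)⁻¹ * ((K : ℝ) / γ)⁻¹ with hh
    have hh0 : 0 < h := by positivity
    have hrate : h ^ (2 * β) = r * R₁ := by
      rw [hh, Real.mul_rpow (by positivity) (by positivity), hR₁, Real.rpow_neg (by positivity),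
        Real.inv_rpow (by positivity : (0 : ℝ) ≤ K / γ)]
    refine le_trans (ENNReal.ofReal_le_ofReal ?_) (le_minimaxRisk_of_bump hA j₀ u₀ D hD.bounded hn
      hL hM hφ hφ0 hφn hφ1 hφs hh0 hb.1 hb.2 (τ := 0) fun d hd => ?_)
    · have hmin : min 1 r * min ((n 0 : ℝ)⁻¹) R₁ ≤ min ((n 0 : ℝ)⁻¹) (h ^ (2 * β)) := by
        rw [hrate]
        refine le_min ?_ ?_
        · calc _ ≤ 1 * (n 0 : ℝ)⁻¹ := by
                gcongr
                · exact min_le_left _ _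
                · exact min_le_left _ _
            _ = _ := one_mul _
        · gcongr
          · exact min_le_right _ _
          · exact min_le_right _ _
      calc _ = e * (Λ * (min 1 q * (min 1 r * min ((n 0 : ℝ)⁻¹) R₁))) := by ring
        _ ≤ _ := by
          gcongr
          exact hexp 0 h0
    · refine (Finset.sum_eq_zero fun k _ => ?_).le
      rw [Set.indicator_of_notMem (hd k)]
      simp
  rw [hmax]
  rcases max_choice R₂ (((∑ k, n k : ℕ) : ℝ)⁻¹) with hmax' | hmax'
  · -- The bump of the width which is optimal for the pooled sample.
    rw [hmax']
    set h : ℝ := (((∑ k, n k : ℕ) : ℝ) / γ) ^ (-1 / (2 * β + 1)) with hh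
    have hh0 : 0 < h := by positivity
    have hrate : h ^ (2 * β) = R₂ := by
      rw [hh, hR₂, ← Real.rpow_mul (by positivity)]
      congr 1
      ring
    have hN : h ^ (2 * β) * h * (((∑ k, n k : ℕ) : ℝ) / γ) ≤ 1 := by
      have h1 : h ^ (2 * β) * h = ((((∑ k, n k : ℕ) : ℝ) / γ))⁻¹ := by
        rw [← Real.rpow_add_one hh0.ne', hh, ← Real.rpow_mul (by positivity),
          div_mul_cancel₀ _ (by positivity), Real.rpow_neg_one]
      rw [h1, inv_mul_cancel₀ (by positivity)]
    have hb := inv_two_le_measure_sum_indicator_le ha₀ hγ hfa hS D hD u₀ hq0 hh0 hN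
    refine le_trans (ENNReal.ofReal_le_ofReal ?_) (le_minimaxRisk_of_bump hA j₀ u₀ D hD.bounded hn
      hL hM hφ hφ0 hφn hφ1 hφs hh0 hb.1 hb.2 (τ := 4 * a₀ * q) fun d hd => hd)
    rw [hrate]
    calc _ = e * (Λ * (min 1 q * min ((n 0 : ℝ)⁻¹) R₂)) * min 1 r := by ring
      _ ≤ e * (Λ * (min 1 q * min ((n 0 : ℝ)⁻¹) R₂)) :=
        mul_le_of_le_one_right (by positivity) (min_le_left _ _)
  · -- Two constant functions at the distance `N^(-1/2)`.
    rw [hmax']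
    refine le_trans (ENNReal.ofReal_le_ofReal ?_) (le_minimaxRisk_of_eigenvalue hA j₀ u₀ D
      hD.bounded (g := fun _ => √(((∑ k, n k : ℕ) : ℝ)⁻¹))
      (fun c _ => isHolder_const l β hL.le _) (G := Set.univ) .univ (by simp)
      (s := 1 + 0) fun d _ => ?_)
    · rw [Real.sq_sqrt (by positivity)]
      calc _ = (e * (Λ * min ((n 0 : ℝ)⁻¹) (((∑ k, n k : ℕ) : ℝ)⁻¹))) *
              (min 1 q * min 1 r) := by ring
        _ ≤ e * (Λ * min ((n 0 : ℝ)⁻¹) (((∑ k, n k : ℕ) : ℝ)⁻¹)) :=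
          mul_le_of_le_one_right (by positivity) hm
        _ ≤ _ := by
          gcongr
          · exact hexp 0 h0
          · exact min_le_right _ _
    · rw [← Finset.sum_mul, Real.sq_sqrt (by positivity), ← Nat.cast_sum,
        mul_inv_cancel₀ hN0.ne', add_zero]
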